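/- All digraphs are reflexive. Let $n\ge 3$ and let $\mathbb{G}$ be an $n$-cycle, i.e. a reflexive digraph on $\{0,\dots,n-1\}$ in which two distinct vertices are joined by an arc (in one or both directions) if and only if they are consecutive modulo $n$. A path of length $k$ is a reflexive digraph on $\{0,\dots,k\}$ in which two distinct vertices $i,j$ are joined by an arc (in one or both directions) if and only if $|i-j|=1$. Paths of length $k$ correspond to words of length $k$ over $\{+,-,*\}$, the $i$-th letter being $+$, $-$ or $*$ according to whether the arcs between $i-1$ and $i$ are $(i-1,i)$ only, $(i,i-1)$ only, or both. For words (or paths) $U,V$ write $U\le V$ if there is a homomorphism from the path of $V$ onto the path of $U$ that sends first vertex to first vertex and last vertex to last vertex. An induced subpath of $\mathbb{G}$ of length $n-2$ is a path of length $n-2$ isomorphic to an induced subdigraph of $\mathbb{G}$. A subpath of $\mathbb{G}$ of length $n-1$ is a path $\mathbb{P}$ of length $n-1$ admitting an injective map $e$ of its vertices into those of $\mathbb{G}$ such that, for consecutive vertices $i,j$ of $\mathbb{P}$, $(i,j)$ is an arc of $\mathbb{P}$ if and only if $(e(i),e(j))$ is an arc of $\mathbb{G}$ (thus $\mathbb{P}$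 is $\mathbb{G}$ with the arc or arcs between one pair of consecutive vertices removed, read in either direction). $\mathbb{G}$ satisfies the path condition if there is no surjective homomorphism $\prod_i\mathbb{Q}_i\to\mathbb{G}$ from a finite product of induced subpaths $\mathbb{Q}_i$ of $\mathbb{G}$ of length $n-2$. Consider the statements: 1. $\mathbb{G}$ satisfies the path condition; 2. for every subpath $\mathbb{P}$ of $\mathbb{G}$ of length $n-1$ there is a word $W$ such that $W\ge\mathbb{Q}$ for every induced subpath $\mathbb{Q}$ of $\mathbb{G}$ of length $n-2$, but $W\not\ge\mathbb{P}$. Then (1) implies (2). If moreover $n\ge 4$, or $\mathbb{G}$ is the directed 3-cycle (no symmetric edge, all arcs between distinct vertices going around in the same direction), then (1) and (2) are equivalent. -/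

import Mathlib

namespace ReflexiveCycle

/-- A path of length `k`: a reflexive digraph on `{0, …, k}` in which two distinct vertices are
joined by an arc (in one or both directions) exactly when they are consecutive. -/
def IsPath {k : ℕ} (P : Digraph (Fin (k + 1))) : Prop :=
  (∀ i, P.Adj i i) ∧
  ∀ i j : Fin (k + 1), i ≠ j →
    ((P.Adj i j ∨ P.Adj j i) ↔ (j.val = i.val + 1 ∨ i.val = j.val + 1))

/-- An `n`-cycle, `n ≥ 3`: a reflexive digraph on `{0, …, n - 1}` in which two distinct vertices
are joined by an arc (in one or both directions) exactly when they are consecutive modulo `n`. -/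
def IsCycle {n : ℕ} (G : Digraph (Fin n)) : Prop :=
  3 ≤ n ∧ (∀ i, G.Adj i i) ∧
  ∀ i j : Fin n, i ≠ j →
    ((G.Adj i j ∨ G.Adj j i) ↔ (j.val = (i.val + 1) % n ∨ i.val = (j.val + 1) % n))

/-- All arcs between distinct vertices of the cycle `G` go around in the same direction,
and none of them is symmetric. -/
def IsDirectedCycle {n : ℕ} (G : Digraph (Fin n)) : Prop :=
  IsCycle G ∧
  ((∀ i j : Fin n, j.val = (i.val + 1) % n → G.Adj i j ∧ ¬ G.Adj j i) ∨
   (∀ i j : Fin n, j.val = (i.val + 1) % n → G.Adj j i ∧ ¬ G.Adj i j))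

/-- The product of a family of digraphs. -/
def prodDigraph {ι : Type*} {V : ι → Type*} (Q : ∀ i, Digraph (V i)) : Digraph (∀ i, V i) where
  Adj x y := ∀ i, (Q i).Adj (x i) (y i)

/-- `H` embeds in `G`: it is isomorphic to an induced subdigraph of `G`. -/
def Embeds {V W : Type*} (H : Digraph V) (G : Digraph W) : Prop :=
  Nonempty (H.Adj ↪r G.Adj)

/-- The path `P` of length `k` is a subpath of `G`: its vertices are placed injectively in `G`, and
between consecutive vertices `P` has exactly the same arcs as `G`. Arcs of `G` between the images
of non-consecutive vertices are allowed; in an `n`-cycle they can occur only for `k = n - 1`, where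
`P` is the cycle with the arc or arcs between one pair of consecutive vertices removed. -/
def IsSubpath {k : ℕ} {V : Type*} (P : Digraph (Fin (k + 1))) (G : Digraph V) : Prop :=
  IsPath P ∧ ∃ e : Fin (k + 1) → V, Function.Injective e ∧
    ∀ i j : Fin (k + 1), (j.val = i.val + 1 ∨ i.val = j.val + 1) →
      (P.Adj i j ↔ G.Adj (e i) (e j))

/-- The alphabet `{+, -, *}`. -/
inductive Letter
  | plus
  | minus
  | star

/-- Words on the alphabet `{+, -, *}`. -/
abbrev Word := List Letter

/-- The path `P(W)` associated to a word `W`: the `i`-th letter (counting from `0`) gives the arc or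
arcs between the vertices `i` and `i + 1`. -/
def pathOf (W : Word) : Digraph (Fin (W.length + 1)) where
  Adj i j := i = j ∨
    (j.val = i.val + 1 ∧ (W[i.val]? = some Letter.plus ∨ W[i.val]? = some Letter.star)) ∨
    (i.val = j.val + 1 ∧ (W[j.val]? = some Letter.minus ∨ W[j.val]? = some Letter.star))

open Classical in
/-- The word `w(P)` of a path `P` of length `k`. -/
noncomputable def wordOf {k : ℕ} (P : Digraph (Fin (k + 1))) : Word :=
  List.ofFn fun i : Fin k =>
    if P.Adj i.castSucc i.succ then
      if P.Adj i.succ i.castSucc then Letter.star else Letter.plus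
    else Letter.minus

/-- The ordering of words: `U ≤ V` if there is an end-point preserving homomorphism from `P(V)`
onto `P(U)`. -/
def WordLE (U V : Word) : Prop :=
  ∃ f : (pathOf V).Adj →r (pathOf U).Adj,
    f 0 = 0 ∧ f (Fin.last V.length) = Fin.last U.length ∧ Function.Surjective f

/-- The path condition: no finite product of paths of length `n - 2` that embed in the `n`-cycle `G`
admits a homomorphism onto `G`. -/
def PathCondition {n : ℕ} (G : Digraph (Fin n)) : Prop :=
  ¬ ∃ (l : ℕ) (Q : Fin l → Digraph (Fin (n - 2 + 1))),
    (∀ i, IsPath (Q i) ∧ Embeds (Q i) G) ∧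
    ∃ f : (prodDigraph Q).Adj →r G.Adj, Function.Surjective f

/-- For every subpath `P` of length `n - 1` some word lies above all induced subpaths of
length `n - 2`, but not above `P`. -/
def WordCondition {n : ℕ} (G : Digraph (Fin n)) : Prop :=
  ∀ P : Digraph (Fin (n - 1 + 1)), IsSubpath P G →
    ∃ W : Word,
      (∀ Q : Digraph (Fin (n - 2 + 1)), IsPath Q → Embeds Q G → WordLE (wordOf Q) W) ∧
      ¬ WordLE (wordOf P) W

end ReflexiveCycle

/-! A word lies above a path exactly when it can be walked along it from the first vertex to the
last (`wordLE_wordOf_iff`). (1) implies (2): suppose every word above all the `Q` is above some `P`.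
In the product of all induced subpaths, the words walked from the all-first corner to the all-last
corner are those above every `Q`, hence can be walked end to end in `P`. Sending `x` to the least
vertex of `P` that bounds the reach of some word leading to `x` is a homomorphism fixing the ends
(`exists_hom_of_walks`). It is onto `P`, and `P` covers `G`. (2) implies (1), `n ≥ 4`: products of
paths contract, so a surjection onto `G` lifts to `F` with values in `ℤ` (`exists_lift_prod`).
Surjectivity makes `F` spread over at least `n` consecutive integers; clipping it to such a window
gives a homomorphism onto a subpath of length `n - 1`, along which the word from (2) is carried, a
contradiction. For the directed 3-cycle, (1) simply holds: a product of single edges has a bottom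
and a top, so its image has at most two vertices. -/

namespace ReflexiveCycle

/-! ### Walks following a word -/

section Walks

variable {V V' : Type*}

/-- A step from `x` to `y` of the shape prescribed by a letter. -/
def Step (D : Digraph V) : Letter → V → V → Prop
  | Letter.plus, x, y => D.Adj x y
  | Letter.minus, x, y => D.Adj y x
  | Letter.star, x, y => D.Adj x y ∧ D.Adj y x

/-- The sequence `c` follows the word `W` in the digraph `D`. -/
def IsWalk (D : Digraph V) (W : Word) (c : ℕ → V) : Prop :=
  ∀ i (h : i < W.length), Step D W[i] (c i) (c (i + 1))

theorem Step.map {D : Digraph V} {D' : Digraph V'} {f : V → V'}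
    (hf : ∀ x y, D.Adj x y → D'.Adj (f x) (f y)) {l : Letter} {x y : V} (h : Step D l x y) :
    Step D' l (f x) (f y) := by
  cases l
  · exact hf _ _ h
  · exact hf _ _ h
  · exact ⟨hf _ _ h.1, hf _ _ h.2⟩

theorem IsWalk.map {D : Digraph V} {D' : Digraph V'} {f : V → V'}
    (hf : ∀ x y, D.Adj x y → D'.Adj (f x) (f y)) {W : Word} {c : ℕ → V} (h : IsWalk D W c) :
    IsWalk D' W (fun i => f (c i)) :=
  fun i hi => (h i hi).map hf

theorem step_prodDigraph {ι : Type*} {V : ι → Type*} {Q : ∀ i, Digraph (V i)} {l : Letter}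
    {x y : ∀ i, V i} : Step (prodDigraph Q) l x y ↔ ∀ i, Step (Q i) l (x i) (y i) := by
  cases l
  · exact Iff.rfl
  · exact Iff.rfl
  · exact forall_and.symm

theorem IsWalk.append {D : Digraph V} {W : Word} {c : ℕ → V} (h : IsWalk D W c) {l : Letter}
    {y : V} (hl : Step D l (c W.length) y) :
    ∃ c' : ℕ → V, IsWalk D (W ++ [l]) c' ∧ c' 0 = c 0 ∧ c' (W ++ [l]).length = y := by
  refine ⟨fun i => if i ≤ W.length then c i else y, ?_, by simp, by simp⟩
  intro i hi
  rw [List.length_append, List.length_singleton] at hi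
  rcases Nat.lt_succ_iff_lt_or_eq.1 hi with h' | rfl
  · have h1 : i ≤ W.length := h'.le
    have h2 : i + 1 ≤ W.length := h'
    simpa [h1, h2, List.getElem_append_left h'] using h i h'
  · simpa using hl

end Walks

/-! ### Retractions of paths, and the word order in terms of walks -/

section Paths

variable {k : ℕ} {P : Digraph (Fin (k + 1))}

theorem IsPath.val_le (hP : IsPath P) {u v : Fin (k + 1)} (h : P.Adj u v) :
    u.val ≤ v.val + 1 ∧ v.val ≤ u.val + 1 := by
  by_cases huv : u = v
  · subst huv; omega
  · have := (hP.2 u v huv).1 (Or.inl h)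
    omega

theorem IsPath.adj_or (hP : IsPath P) {u v : Fin (k + 1)} (h : v.val = u.val + 1) :
    P.Adj u v ∨ P.Adj v u :=
  (hP.2 u v (by rintro rfl; omega)).2 (Or.inl h)

/-- Clipping retracts the path onto an initial segment: an arc straddling `b` must have `b` as an
end. -/
theorem IsPath.adj_min (hP : IsPath P) (b : Fin (k + 1)) {u v : Fin (k + 1)} (h : P.Adj u v) :
    P.Adj (min u b) (min v b) := by
  have h' := hP.val_le h
  rcases le_total u b with h1 | h1 <;> rcases le_total v b with h2 | h2
  · simpa [h1, h2] using h
  · rw [min_eq_left h1, min_eq_right h2]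
    rw [Fin.le_def] at h1 h2
    rcases (show u = b ∨ v = b by simp only [Fin.ext_iff]; omega) with rfl | rfl
    · exact hP.1 _
    · exact h
  · rw [min_eq_right h1, min_eq_left h2]
    rw [Fin.le_def] at h1 h2
    rcases (show u = b ∨ v = b by simp only [Fin.ext_iff]; omega) with rfl | rfl
    · exact h
    · exact hP.1 _
  · simpa [h1, h2] using hP.1 b

theorem IsPath.adj_max (hP : IsPath P) (b : Fin (k + 1)) {u v : Fin (k + 1)} (h : P.Adj u v) :
    P.Adj (max u b) (max v b) := by
  have h' := hP.val_le h
  rcases le_total u b with h1 | h1 <;> rcases le_total v b with h2 | h2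
  · simpa [h1, h2] using hP.1 b
  · rw [max_eq_right h1, max_eq_left h2]
    rw [Fin.le_def] at h1 h2
    rcases (show u = b ∨ v = b by simp only [Fin.ext_iff]; omega) with rfl | rfl
    · exact h
    · exact hP.1 _
  · rw [max_eq_left h1, max_eq_right h2]
    rw [Fin.le_def] at h1 h2
    rcases (show u = b ∨ v = b by simp only [Fin.ext_iff]; omega) with rfl | rfl
    · exact hP.1 _
    · exact h
  · simpa [h1, h2] using h

/-- The path read backwards. -/
def reverse (P : Digraph (Fin (k + 1))) : Digraph (Fin (k + 1)) where
  Adj i j := P.Adj i.rev j.rev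

theorem IsPath.reverse (hP : IsPath P) : IsPath (reverse P) := by
  refine ⟨fun i => hP.1 _, fun i j hij => ?_⟩
  have := hP.2 i.rev j.rev (fun h => hij (Fin.rev_injective h))
  rw [Fin.val_rev, Fin.val_rev] at this
  exact this.trans (by omega)

theorem Embeds.reverse {V : Type*} {G : Digraph V} (h : Embeds P G) : Embeds (reverse P) G := by
  obtain ⟨e⟩ := h
  exact ⟨⟨⟨fun i => e i.rev, fun i j hij => Fin.rev_injective (e.injective hij)⟩,
    e.map_rel_iff⟩⟩

theorem IsWalk.val_succ (hP : IsPath P) {W : Word} {c : ℕ → Fin (k + 1)} (h : IsWalk P W c)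
    {i : ℕ} (hi : i < W.length) : (c (i + 1)).val ≤ (c i).val + 1 := by
  have := h i hi
  generalize W[i] = l at this
  cases l
  · exact (hP.val_le this).2
  · exact (hP.val_le this).1
  · exact (hP.val_le this.1).2

/-- Discrete intermediate values; this makes surjectivity in `WordLE` automatic. -/
theorem IsWalk.exists_eq (hP : IsPath P) {W : Word} {c : ℕ → Fin (k + 1)} (h : IsWalk P W c)
    (h0 : c 0 = 0) (i : ℕ) (hi : i ≤ W.length) (s : ℕ) (hs : s ≤ (c i).val) :
    ∃ j ≤ W.length, (c j).val = s := by
  induction i generalizing s with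
  | zero => exact ⟨0, hi, by rw [h0] at hs ⊢; simp at hs ⊢; omega⟩
  | succ i ih =>
    rcases Nat.lt_or_ge (c i).val s with h' | h'
    · have := h.val_succ hP (i := i) hi
      exact ⟨i + 1, hi, by omega⟩
    · exact ih (by omega) s h'

@[simp] theorem length_wordOf (P : Digraph (Fin (k + 1))) : (wordOf P).length = k := by
  simp [wordOf]

theorem pathOf_wordOf_adj (hP : IsPath P) (i j : Fin ((wordOf P).length + 1)) :
    (pathOf (wordOf P)).Adj i j ↔
      P.Adj (i.cast (by rw [length_wordOf])) (j.cast (by rw [length_wordOf])) := by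
  have key : ∀ (i j : Fin ((wordOf P).length + 1)), j.val = i.val + 1 →
      (((wordOf P)[i.val]? = some Letter.plus ∨ (wordOf P)[i.val]? = some Letter.star) ↔
        P.Adj (i.cast (by rw [length_wordOf])) (j.cast (by rw [length_wordOf]))) ∧
      (((wordOf P)[i.val]? = some Letter.minus ∨ (wordOf P)[i.val]? = some Letter.star) ↔
        P.Adj (j.cast (by rw [length_wordOf])) (i.cast (by rw [length_wordOf]))) := by
    intro i j hij
    have hik : i.val < k := by
      have h1 := j.2
      have h2 := length_wordOf P
      omega
    have e1 : i.cast (by rw [length_wordOf]) = (⟨i.val, hik⟩ : Fin k).castSucc := rfl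
    have e2 : j.cast (by rw [length_wordOf]) = (⟨i.val, hik⟩ : Fin k).succ := Fin.ext hij
    have hor := hP.adj_or (u := (⟨i.val, hik⟩ : Fin k).castSucc) (v := (⟨i.val, hik⟩ : Fin k).succ)
      (by simp)
    rw [e1, e2]
    simp only [wordOf, List.getElem?_ofFn, hik, dif_pos, Option.some.injEq]
    split_ifs with h1 h2
    · simp only [h1, h2]; simp
    · simp only [h1, h2]; simp
    · simp only [h1, false_or] at hor
      simp only [h1, hor]; simp
  have hne : (i = j) ↔ (i.cast (by rw [length_wordOf]) : Fin (k + 1)) =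
      j.cast (by rw [length_wordOf]) := by simp [Fin.ext_iff]
  constructor
  · rintro (rfl | ⟨h, h'⟩ | ⟨h, h'⟩)
    · exact hP.1 _
    · exact (key i j h).1.1 h'
    · exact (key j i h).2.1 h'
  · intro h
    by_cases hij : i = j
    · exact Or.inl hij
    · rcases (hP.2 _ _ (fun e => hij (hne.2 e))).1 (Or.inl h) with h' | h'
      · exact Or.inr (Or.inl ⟨h', (key i j h').1.2 h⟩)
      · exact Or.inr (Or.inr ⟨h', (key j i h').2.2 h⟩)

theorem wordLE_wordOf_iff (hP : IsPath P) (W : Word) :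
    WordLE (wordOf P) W ↔
      ∃ c : ℕ → Fin (k + 1), IsWalk P W c ∧ c 0 = 0 ∧ c W.length = Fin.last k := by
  constructor
  · rintro ⟨f, h0, h1, -⟩
    refine ⟨fun i => (f ⟨min i W.length, by omega⟩).cast (by rw [length_wordOf]), ?_, ?_, ?_⟩
    · intro i hi
      have ha : ∀ u v, (pathOf W).Adj u v → P.Adj ((f u).cast (by rw [length_wordOf]))
          ((f v).cast (by rw [length_wordOf])) :=
        fun u v h => (pathOf_wordOf_adj hP _ _).1 (f.map_rel h)
      refine Step.map (D := pathOf W)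
        (f := fun u => ((f u).cast (by rw [length_wordOf]) : Fin (k + 1))) ha ?_
      have e1 : min i W.length = i := by omega
      have e2 : min (i + 1) W.length = i + 1 := by omega
      have hW : W[i]? = some W[i] := List.getElem?_eq_getElem hi
      simp only [e1, e2]
      generalize W[i] = l at hW
      cases l <;> simp [Step, pathOf, hW]
    · have : (⟨min 0 W.length, by omega⟩ : Fin (W.length + 1)) = 0 := by ext; simp
      simp only [this, h0]
      ext; simp
    · have : (⟨min W.length W.length, by omega⟩ : Fin (W.length + 1)) = Fin.last _ := by
        ext; simp
      simp only [this, h1]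
      ext; simp
  · rintro ⟨c, hc, h0, h1⟩
    refine ⟨⟨fun u => (c u.val).cast (by rw [length_wordOf]), ?_⟩, ?_, ?_, ?_⟩
    · intro u v huv
      rw [pathOf_wordOf_adj hP]
      simp only [Fin.cast_cast, Fin.cast_eq_self]
      rcases huv with rfl | ⟨h, h'⟩ | ⟨h, h'⟩
      · exact hP.1 _
      · have hu : u.val < W.length := by omega
        have := hc u.val hu
        rw [← h] at this
        rw [List.getElem?_eq_getElem hu, Option.some.injEq, Option.some.injEq] at h'
        rcases h' with h' | h' <;> rw [h'] at this
        · exact this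
        · exact this.1
      · have hv : v.val < W.length := by omega
        have := hc v.val hv
        rw [← h] at this
        rw [List.getElem?_eq_getElem hv, Option.some.injEq, Option.some.injEq] at h'
        rcases h' with h' | h' <;> rw [h'] at this
        · exact this
        · exact this.2
    · ext; simp [h0]
    · ext; simp [h1]
    · intro s
      obtain ⟨j, hj, hjs⟩ := hc.exists_eq hP h0 W.length le_rfl s.val (by
        have h2 := s.2
        have h3 := length_wordOf P
        rw [h1, Fin.val_last]
        omega)
      exact ⟨⟨j, by omega⟩, Fin.ext hjs⟩

/-- A word lying above a path and its reverse can be walked between any two vertices of it. -/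
theorem IsPath.exists_isWalk (hP : IsPath P) {W : Word} (h : WordLE (wordOf P) W)
    (h' : WordLE (wordOf (ReflexiveCycle.reverse P)) W) (a b : Fin (k + 1)) :
    ∃ c : ℕ → Fin (k + 1), IsWalk P W c ∧ c 0 = a ∧ c W.length = b := by
  rw [wordLE_wordOf_iff hP] at h
  rw [wordLE_wordOf_iff hP.reverse] at h'
  rcases le_total a b with hab | hab
  · obtain ⟨c, hc, h0, h1⟩ := h
    refine ⟨fun i => max (min (c i) b) a,
      hc.map (f := fun x => max (min x b) a) fun x y hxy => hP.adj_max a (hP.adj_min b hxy),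
      ?_, ?_⟩
    · simp [h0]
    · simp [h1, hab, Fin.le_last]
  -- To go downwards, reflect a walk in the reversed path, then clip it.
  · obtain ⟨c, hc, h0, h1⟩ := h'
    refine ⟨fun i => max (min (c i).rev a) b,
      hc.map (f := fun x : Fin (k + 1) => max (min x.rev a) b) fun x y hxy =>
        hP.adj_max b (hP.adj_min a hxy), ?_, ?_⟩
    · simp [h0, hab, Fin.le_last]
    · simp [h1]

end Paths

/-! ### Greedy reach of a word, and the homomorphism it defines -/

section Reach

variable {V : Type*} {k : ℕ}

open Classical in
/-- The last vertex of `P` that a step of shape `l` reaches from the vertices `0, …, s`. -/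
noncomputable def nextReach (P : Digraph (Fin (k + 1))) (s : ℕ) (l : Letter) : ℕ :=
  if ∃ h : s + 1 < k + 1, Step P l ⟨s, by omega⟩ ⟨s + 1, h⟩ then s + 1 else s

/-- The last vertex of `P` that a walk of shape `W` reaches from the vertex `0`. -/
noncomputable def reach (P : Digraph (Fin (k + 1))) (W : Word) : ℕ :=
  W.foldl (nextReach P) 0

theorem reach_append (P : Digraph (Fin (k + 1))) (W : Word) (l : Letter) :
    reach P (W ++ [l]) = nextReach P (reach P W) l := by
  simp [reach]

theorem le_nextReach (P : Digraph (Fin (k + 1))) (s : ℕ) (l : Letter) : s ≤ nextReach P s l := by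
  unfold nextReach; split_ifs <;> omega

theorem nextReach_le (P : Digraph (Fin (k + 1))) {s : ℕ} (hs : s ≤ k) (l : Letter) :
    nextReach P s l ≤ k := by
  unfold nextReach
  split_ifs with h
  · obtain ⟨h, -⟩ := h; omega
  · exact hs

theorem reach_le (P : Digraph (Fin (k + 1))) (W : Word) : reach P W ≤ k := by
  induction W using List.reverseRecOn with
  | nil => simp [reach]
  | append_singleton W l ih => rw [reach_append]; exact nextReach_le P ih l

/-- Greedy advance is optimal: a walk moves by at most one, so it could overtake the frontier only
from the frontier itself, by a step the frontier also takes. -/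
theorem IsWalk.le_reach {P : Digraph (Fin (k + 1))} (hP : IsPath P) {W : Word}
    {c : ℕ → Fin (k + 1)} (h : IsWalk P W c) (h0 : c 0 = 0) : (c W.length).val ≤ reach P W := by
  induction W using List.reverseRecOn with
  | nil => simp [h0]
  | append_singleton W l ih =>
    have hW : IsWalk P W c := fun i hi => by
      have := h i (by simp; omega)
      rwa [List.getElem_append_left hi] at this
    have hl : Step P l (c W.length) (c (W.length + 1)) := by
      have := h W.length (by simp)
      simpa using this
    have hs := h.val_succ hP (i := W.length) (by simp)
    have ih := ih hW
    rw [reach_append, List.length_append, List.length_singleton]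
    by_contra! hlt
    have := le_nextReach P (reach P W) l
    have e1 : (c W.length).val = reach P W := by omega
    have e2 : (c (W.length + 1)).val = reach P W + 1 := by omega
    have : nextReach P (reach P W) l = reach P W + 1 := by
      unfold nextReach
      refine if_pos ⟨by have := (c (W.length + 1)).2; omega, ?_⟩
      convert hl using 1
      · exact Fin.ext e1.symm
      · exact Fin.ext e2.symm
    omega

/-- The words that can be walked in `D` from `a` to `x`. -/
def walksTo (D : Digraph V) (a x : V) : Set Word :=
  {W | ∃ c : ℕ → V, IsWalk D W c ∧ c 0 = a ∧ c W.length = x}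

theorem append_mem_walksTo {D : Digraph V} {a x y : V} {W : Word} (hW : W ∈ walksTo D a x)
    {l : Letter} (hl : Step D l x y) : W ++ [l] ∈ walksTo D a y := by
  obtain ⟨c, hc, h0, h1⟩ := hW
  obtain ⟨c', hc', h0', h1'⟩ := hc.append (l := l) (y := y) (by rwa [h1])
  exact ⟨c', hc', h0'.trans h0, h1'⟩

/-- The least reach in `P` of a walk from `a` to `x`. -/
noncomputable def minReach (D : Digraph V) (a : V) (P : Digraph (Fin (k + 1))) (x : V) : ℕ :=
  sInf (reach P '' walksTo D a x)

theorem exists_reach_eq {D : Digraph V} {a : V} (P : Digraph (Fin (k + 1))) {x : V}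
    (h : (walksTo D a x).Nonempty) : ∃ W ∈ walksTo D a x, reach P W = minReach D a P x :=
  Nat.sInf_mem (h.image (reach P))

theorem minReach_le {D : Digraph V} {a : V} (P : Digraph (Fin (k + 1))) {x : V} {W : Word}
    (h : W ∈ walksTo D a x) : minReach D a P x ≤ reach P W :=
  Nat.sInf_le (Set.mem_image_of_mem _ h)

theorem minReach_lt {D : Digraph V} {a : V} (P : Digraph (Fin (k + 1))) {x : V}
    (h : (walksTo D a x).Nonempty) : minReach D a P x < k + 1 := by
  obtain ⟨W, -, hW⟩ := exists_reach_eq P h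
  rw [← hW]
  exact Nat.lt_succ_of_le (reach_le P W)

theorem minReach_le_nextReach {D : Digraph V} {a : V} (P : Digraph (Fin (k + 1))) {x y : V}
    (h : (walksTo D a x).Nonempty) {l : Letter} (hl : Step D l x y) :
    minReach D a P y ≤ nextReach P (minReach D a P x) l := by
  obtain ⟨W, hW, hr⟩ := exists_reach_eq P h
  rw [← hr, ← reach_append]
  exact minReach_le P (append_mem_walksTo hW hl)

/-- If every word that can be walked from `a` to `b` can be walked along the path `P`, then `P`
is the target of a homomorphism sending `a` and `b` to the ends. -/
theorem exists_hom_of_walks {D : Digraph V} {a b : V} {P : Digraph (Fin (k + 1))} (hP : IsPath P)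
    (hconn : ∀ x, (walksTo D a x).Nonempty)
    (hW : ∀ W ∈ walksTo D a b,
      ∃ c : ℕ → Fin (k + 1), IsWalk P W c ∧ c 0 = 0 ∧ c W.length = Fin.last k) :
    ∃ f : V → Fin (k + 1), (∀ x y, D.Adj x y → P.Adj (f x) (f y)) ∧ f a = 0 ∧
      f b = Fin.last k := by
  refine ⟨fun x => ⟨minReach D a P x, minReach_lt P (hconn x)⟩, ?_, ?_, ?_⟩
  · intro x y hxy
    have hx := minReach_lt P (hconn x)
    have hy := minReach_lt P (hconn y)
    -- The arc is read as `+` from `x` and as `-` from `y`. An increase is thus by one, along a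
    -- forward arc of `P`; a decrease is by one, along a backward arc.
    have h1 := minReach_le_nextReach P (hconn x) (l := Letter.plus) hxy
    have h2 := minReach_le_nextReach P (hconn y) (l := Letter.minus) hxy
    change P.Adj ⟨minReach D a P x, hx⟩ ⟨minReach D a P y, hy⟩
    generalize minReach D a P x = s at *
    generalize minReach D a P y = t at *
    unfold nextReach at h1 h2
    rcases lt_trichotomy s t with hst | rfl | hst
    · split_ifs at h1 with h
      · obtain rfl : t = s + 1 := by omega
        exact h.2
      · omega
    · exact hP.1 _
    · split_ifs at h2 with h
      · obtain rfl : s = t + 1 := by omega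
        exact h.2
      · omega
  · have : [] ∈ walksTo D a a := ⟨fun _ => a, fun i hi => by simp at hi, rfl, rfl⟩
    have := minReach_le P this
    simp only [reach, List.foldl_nil] at this
    exact Fin.ext (by simpa using this)
  · obtain ⟨W, hWb, hr⟩ := exists_reach_eq P (hconn b)
    obtain ⟨c, hc, h0, h1⟩ := hW W hWb
    have := hc.le_reach hP h0
    rw [h1, Fin.val_last] at this
    have := reach_le P W
    exact Fin.ext (by simp; omega)

end Reach

/-! ### Contractibility and connectedness of products of paths -/

section Products

variable {l k : ℕ} {Q : Fin l → Digraph (Fin (k + 1))}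

/-- Serves to raise truncation bounds one unit at a time, from a constant map to the identity. -/
theorem nat_pi_induction {l : ℕ} {p : (Fin l → ℕ) → Prop} (h0 : p 0)
    (hs : ∀ t i, p t → p (Function.update t i (t i + 1))) (t : Fin l → ℕ) : p t := by
  generalize hN : ∑ i, t i = N
  induction N generalizing t with
  | zero =>
    have : t = 0 := funext fun i => by
      simpa using (Finset.sum_eq_zero_iff.1 hN) i (Finset.mem_univ i)
    rwa [this]
  | succ N ih =>
    obtain ⟨i, -, hi⟩ : ∃ i ∈ Finset.univ, t i ≠ 0 := Finset.exists_ne_zero_of_sum_ne_zero (by omega)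
    have h1 := Finset.sum_update_of_mem (Finset.mem_univ i) t (t i - 1)
    have h2 := Finset.sum_update_of_mem (Finset.mem_univ i) t (t i)
    rw [Function.update_eq_self] at h2
    have := hs _ i (ih (Function.update t i (t i - 1)) (by omega))
    simpa [Nat.sub_add_cancel (Nat.one_le_iff_ne_zero.2 hi)] using this

/-- Truncation of a point of a power of `{0, …, k}` at the bounds `t`. -/
def trunc (t : Fin l → ℕ) (x : Fin l → Fin (k + 1)) : Fin l → Fin (k + 1) :=
  fun i => ⟨min (x i).val (t i), by omega⟩

theorem trunc_update_of_ne (t : Fin l → ℕ) {i j : Fin l} (h : j ≠ i) (s : ℕ)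
    (x : Fin l → Fin (k + 1)) : trunc (Function.update t i s) x j = trunc t x j := by
  simp [trunc, h]

theorem trunc_adj (hQ : ∀ i, IsPath (Q i)) (t : Fin l → ℕ) {x y : Fin l → Fin (k + 1)}
    (h : (prodDigraph Q).Adj x y) : (prodDigraph Q).Adj (trunc t x) (trunc t y) := by
  intro i
  rcases Nat.lt_or_ge (t i) (k + 1) with ht | ht
  · have := (hQ i).adj_min ⟨t i, ht⟩ (h i)
    convert this using 1 <;>
    · ext; simp [trunc]
  · have e : ∀ x : Fin l → Fin (k + 1), trunc t x i = x i := fun x => by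
      ext; simp only [trunc]; omega
    rw [e, e]
    exact h i

/-- Raising one of the bounds moves truncated points along arcs, and the square over any arc has
a diagonal. -/
theorem trunc_update_adj (hQ : ∀ i, IsPath (Q i)) (t : Fin l → ℕ) (i : Fin l)
    {x y : Fin l → Fin (k + 1)} (h : (prodDigraph Q).Adj x y) :
    (prodDigraph Q).Adj (trunc t x) (trunc (Function.update t i (t i + 1)) y) ∨
      (prodDigraph Q).Adj (trunc (Function.update t i (t i + 1)) x) (trunc t y) := by
  have hi : (Q i).Adj (trunc t x i) (trunc (Function.update t i (t i + 1)) y i) ∨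
      (Q i).Adj (trunc (Function.update t i (t i + 1)) x i) (trunc t y i) := by
    have hv := (hQ i).val_le (h i)
    have h1 := trunc_adj hQ t h i
    by_cases hx : (x i).val ≤ t i
    · have e : trunc (Function.update t i (t i + 1)) x i = trunc t x i := by
        ext; simp [trunc]; omega
      exact Or.inr (by rwa [e])
    by_cases hy : (y i).val ≤ t i
    · have e : trunc (Function.update t i (t i + 1)) y i = trunc t y i := by
        ext; simp [trunc]; omega
      exact Or.inl (by rwa [e])
    -- Both coordinates exceed the bound, so each moves from `t i` to `t i + 1`; the direction of an
    -- arc between these picks the diagonal.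
    have e1 : trunc t x i = trunc t y i := by ext; simp only [trunc]; omega
    have e2 : trunc (Function.update t i (t i + 1)) x i =
        trunc (Function.update t i (t i + 1)) y i := by ext; simp [trunc]; omega
    rw [e2, e1]
    exact (hQ i).adj_or (by simp [trunc]; omega)
  refine hi.imp (fun hi j => ?_) (fun hi j => ?_) <;>
  · by_cases hj : j = i
    · subst hj; exact hi
    · rw [trunc_update_of_ne t hj]
      exact trunc_adj hQ t h j

theorem prodDigraph_refl (hQ : ∀ i, IsPath (Q i)) (x : Fin l → Fin (k + 1)) :
    (prodDigraph Q).Adj x x := fun i => (hQ i).1 _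

theorem trunc_zero (x : Fin l → Fin (k + 1)) : trunc 0 x = 0 := by
  funext i; ext; simp [trunc]

theorem trunc_const (x : Fin l → Fin (k + 1)) : trunc (fun _ => k) x = x := by
  funext i; ext; simp only [trunc]; omega

theorem prod_connected (hQ : ∀ i, IsPath (Q i)) {p : (Fin l → Fin (k + 1)) → Prop} (h0 : p 0)
    (hs : ∀ x y, p x → (prodDigraph Q).Adj x y ∨ (prodDigraph Q).Adj y x → p y)
    (x : Fin l → Fin (k + 1)) : p x := by
  rw [← trunc_const x]
  refine nat_pi_induction (p := fun t => p (trunc t x)) ?_ ?_ _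
  · rwa [trunc_zero]
  · intro t i ht
    exact hs _ _ ht (trunc_update_adj hQ t i (prodDigraph_refl hQ x))

theorem walksTo_prod_nonempty (hQ : ∀ i, IsPath (Q i)) (x : Fin l → Fin (k + 1)) :
    (walksTo (prodDigraph Q) 0 x).Nonempty := by
  refine prod_connected hQ (p := fun x => (walksTo (prodDigraph Q) 0 x).Nonempty) ?_ ?_ x
  · exact ⟨[], fun _ => 0, fun i hi => by simp at hi, rfl, rfl⟩
  · rintro x y ⟨W, hW⟩ (h | h)
    · exact ⟨_, append_mem_walksTo (l := Letter.plus) hW h⟩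
    · exact ⟨_, append_mem_walksTo (l := Letter.minus) hW h⟩

theorem surjective_of_ends (hQ : ∀ i, IsPath (Q i)) {m : ℕ} {P : Digraph (Fin (m + 1))}
    (hP : IsPath P) {f : (Fin l → Fin (k + 1)) → Fin (m + 1)}
    (hf : ∀ x y, (prodDigraph Q).Adj x y → P.Adj (f x) (f y)) (h0 : f 0 = 0)
    {b : Fin l → Fin (k + 1)} (hb : f b = Fin.last m) : Function.Surjective f := by
  intro s
  refine prod_connected hQ (p := fun x => ∀ s, s ≤ f x → ∃ y, f y = s) ?_ ?_ b s
    (by rw [hb]; exact Fin.le_last s)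
  · intro s hs
    rw [h0] at hs
    exact ⟨0, by rw [h0]; exact (Fin.le_zero_iff.1 hs).symm⟩
  · intro x y hx hxy s hs
    have hv : (f y).val ≤ (f x).val + 1 :=
      hxy.elim (fun h => (hP.val_le (hf _ _ h)).2) (fun h => (hP.val_le (hf _ _ h)).1)
    rcases le_or_gt s (f x) with h | h
    · exact hx s h
    · exact ⟨y, Fin.ext (by rw [Fin.le_def] at hs; rw [Fin.lt_def] at h; omega)⟩

end Products

/-! ### Lifting to the universal cover and unrolling the cycle -/

section Lift

variable {n : ℕ} {G : Digraph (Fin n)}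

theorem IsCycle.exists_int (hG : IsCycle G) {u v : Fin n} (h : G.Adj u v) :
    ∃ e : ℤ, |e| ≤ 1 ∧ (n : ℤ) ∣ (v.val : ℤ) - u.val - e := by
  by_cases huv : u = v
  · exact ⟨0, by simp, by simp [huv]⟩
  have hmod : ∀ a : ℕ, (n : ℤ) ∣ ((a + 1) % n : ℕ) - (a : ℤ) - 1 := fun a => by
    push_cast
    have := Int.mul_ediv_add_emod ((a : ℤ) + 1) n
    exact ⟨-(((a : ℤ) + 1) / n), by linarith⟩
  rcases (hG.2.2 u v huv).1 (Or.inl h) with h | h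
  · exact ⟨1, by simp, by rw [h]; exact hmod u.val⟩
  · refine ⟨-1, by simp, ?_⟩
    obtain ⟨p, hp⟩ := hmod v.val
    rw [← h] at hp
    exact ⟨-p, by linarith⟩

/-- The place where `n ≥ 4` is essential: `|d - e| ≤ 3 < n` forces `d = e`. -/
theorem abs_le_one_of_dvd (hn : 4 ≤ n) {d e : ℤ} (hd : |d| ≤ 2) (he : |e| ≤ 1)
    (h : (n : ℤ) ∣ d - e) : |d| ≤ 1 := by
  have : d - e = 0 := Int.eq_zero_of_abs_lt_dvd h (by
    have := abs_sub d e
    have : (4 : ℤ) ≤ n := by exact_mod_cast hn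
    linarith)
  rwa [sub_eq_zero.1 this]

/-- `F` lifts the map `g` to the universal cover `ℤ` of the `n`-cycle. -/
def IsLift {V : Type*} (D : Digraph V) (g : V → Fin n) (F : V → ℤ) : Prop :=
  (∀ x, (n : ℤ) ∣ F x - (g x).val) ∧ ∀ x y, D.Adj x y → |F y - F x| ≤ 1

/-- Lift `g'` pointwise within distance 1 of `F`. The diagonal splits each square into two
triangles; in each, two sides of size at most 1 bound the third by 2, and `abs_le_one_of_dvd`
improves this to 1. -/
theorem exists_lift_of_homotopic (hn : 4 ≤ n) (hG : IsCycle G) {V : Type*} {D : Digraph V}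
    (hD : ∀ x, D.Adj x x) {g g' : V → Fin n} (hg' : ∀ x y, D.Adj x y → G.Adj (g' x) (g' y))
    (hgg : ∀ x y, D.Adj x y → G.Adj (g x) (g' y) ∨ G.Adj (g' x) (g y))
    (h : ∃ F, IsLift D g F) : ∃ F, IsLift D g' F := by
  obtain ⟨F, hF, hF1⟩ := h
  have step : ∀ {u v : Fin n} {a b : ℤ}, G.Adj u v → (n : ℤ) ∣ a - u.val → (n : ℤ) ∣ b - v.val →
      |b - a| ≤ 2 → |b - a| ≤ 1 := by
    intro u v a b huv ha hb hab
    obtain ⟨e, he, hd⟩ := hG.exists_int huv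
    obtain ⟨p, hp⟩ := ha
    obtain ⟨q, hq⟩ := hb
    obtain ⟨r, hr⟩ := hd
    exact abs_le_one_of_dvd hn hab he ⟨q - p + r, by linarith⟩
  have hex : ∀ x, ∃ z : ℤ, (n : ℤ) ∣ z - (g' x).val ∧ |z - F x| ≤ 1 := by
    intro x
    obtain ⟨p, hp⟩ := hF x
    rcases hgg x x (hD x) with h | h <;> obtain ⟨e, he, q, hq⟩ := hG.exists_int h
    · exact ⟨F x + e, ⟨p - q, by linarith⟩, by simpa using he⟩
    · exact ⟨F x - e, ⟨p + q, by linarith⟩, by simpa using he⟩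
  choose F' hF' hFF' using hex
  refine ⟨F', hF', fun x y hxy => step (hg' x y hxy) (hF' x) (hF' y) ?_⟩
  have h1 := hF1 x y hxy
  have hx := hFF' x
  have hy := hFF' y
  rcases hgg x y hxy with h | h
  · have := step h (hF x) (hF' y) (by rw [abs_le] at *; constructor <;> linarith)
    rw [abs_le] at *; constructor <;> linarith
  · have := step h (hF' x) (hF y) (by rw [abs_le] at *; constructor <;> linarith)
    rw [abs_le] at *; constructor <;> linarith

theorem exists_lift_prod (hn : 4 ≤ n) (hG : IsCycle G) {l k : ℕ}
    {Q : Fin l → Digraph (Fin (k + 1))} (hQ : ∀ i, IsPath (Q i)) {f : (Fin l → Fin (k + 1)) → Fin n}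
    (hf : ∀ x y, (prodDigraph Q).Adj x y → G.Adj (f x) (f y)) :
    ∃ F, IsLift (prodDigraph Q) f F := by
  have key : ∀ t : Fin l → ℕ, ∃ F, IsLift (prodDigraph Q) (fun x => f (trunc t x)) F := by
    refine nat_pi_induction ?_ ?_
    · exact ⟨fun _ => (f 0).val, fun x => by simp [trunc_zero], fun x y _ => by simp⟩
    · intro t i ht
      exact exists_lift_of_homotopic hn hG (prodDigraph_refl hQ)
        (fun x y h => hf _ _ (trunc_adj hQ _ h))
        (fun x y h => (trunc_update_adj hQ t i h).imp (hf _ _) (hf _ _)) ht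
  simpa only [trunc_const] using key fun _ => k

/-- The residue of an integer as a vertex of the cycle. -/
def residue (n : ℕ) (hn : 0 < n) (z : ℤ) : Fin n :=
  ⟨(z % n).toNat, by
    have := Int.emod_lt_of_pos z (show (0 : ℤ) < n by exact_mod_cast hn)
    have := Int.emod_nonneg z (show (n : ℤ) ≠ 0 by omega)
    omega⟩

theorem residue_val (hn : 0 < n) (z : ℤ) : ((residue n hn z).val : ℤ) = z % n := by
  have := Int.emod_nonneg z (show (n : ℤ) ≠ 0 by omega)
  simp only [residue]; omega

theorem residue_eq_iff (hn : 0 < n) {z w : ℤ} :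
    residue n hn z = residue n hn w ↔ (n : ℤ) ∣ z - w := by
  rw [Fin.ext_iff, ← Int.natCast_inj, residue_val, residue_val]
  exact Int.emod_eq_emod_iff_emod_sub_eq_zero.trans Int.dvd_iff_emod_eq_zero.symm

theorem residue_eq_of_dvd (hn : 0 < n) {z : ℤ} {u : Fin n} (h : (n : ℤ) ∣ z - u.val) :
    residue n hn z = u := by
  have : residue n hn u.val = u := by
    rw [Fin.ext_iff, ← Int.natCast_inj, residue_val]
    exact Int.emod_eq_of_lt (by omega) (by have := u.2; omega)
  rw [← this]
  exact (residue_eq_iff hn).2 h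

theorem IsCycle.residue_adj (hG : IsCycle G) (hn : 0 < n) (z : ℤ) :
    G.Adj (residue n hn z) (residue n hn (z + 1)) ∨
      G.Adj (residue n hn (z + 1)) (residue n hn z) := by
  have h3 := hG.1
  refine (hG.2.2 _ _ ?_).2 (Or.inl ?_)
  · rw [Ne, residue_eq_iff]
    intro h
    have := Int.eq_zero_of_abs_lt_dvd h (by
      rw [show z - (z + 1) = -1 by ring]; simp; omega)
    omega
  · zify
    rw [residue_val, residue_val]
    simp

/-- The path of length `k` obtained by unrolling `G` from the integer `m`. -/
def unroll (hn : 0 < n) (G : Digraph (Fin n)) (m : ℤ) (k : ℕ) : Digraph (Fin (k + 1)) where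
  Adj i j := i.val ≤ j.val + 1 ∧ j.val ≤ i.val + 1 ∧
    G.Adj (residue n hn (m + i.val)) (residue n hn (m + j.val))

theorem isPath_unroll (hG : IsCycle G) (hn : 0 < n) (m : ℤ) (k : ℕ) :
    IsPath (unroll hn G m k) := by
  refine ⟨fun i => ⟨by omega, by omega, hG.2.1 _⟩, fun i j hij => ⟨fun h => ?_, fun h => ?_⟩⟩
  · have : i.val ≠ j.val := fun h => hij (Fin.ext h)
    rcases h with ⟨h1, h2, -⟩ | ⟨h1, h2, -⟩ <;> omega
  · rcases h with h | h
    · have := hG.residue_adj hn (m + i.val)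
      rw [show m + (i.val : ℤ) + 1 = m + j.val by omega] at this
      exact this.imp (fun h' => ⟨by omega, by omega, h'⟩) (fun h' => ⟨by omega, by omega, h'⟩)
    · have := hG.residue_adj hn (m + j.val)
      rw [show m + (j.val : ℤ) + 1 = m + i.val by omega] at this
      exact this.symm.imp (fun h' => ⟨by omega, by omega, h'⟩) (fun h' => ⟨by omega, by omega, h'⟩)

theorem isSubpath_unroll (hG : IsCycle G) (hn : 0 < n) (m : ℤ) :
    IsSubpath (unroll hn G m (n - 1)) G := by
  refine ⟨isPath_unroll hG hn m _, fun i => residue n hn (m + i.val), ?_, ?_⟩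
  · intro i j hij
    have h := (residue_eq_iff hn).1 hij
    have hi := i.2
    have hj := j.2
    have := Int.eq_zero_of_abs_lt_dvd h (by rw [abs_lt]; constructor <;> omega)
    exact Fin.ext (by omega)
  · intro i j hij
    exact ⟨fun h => h.2.2, fun h => ⟨by omega, by omega, h⟩⟩

end Lift

/-! ### The two implications and the directed triangle -/

section Main

variable {n : ℕ} {G : Digraph (Fin n)}

theorem IsSubpath.exists_bijective_hom (hn : 0 < n) (hG : IsCycle G)
    {P : Digraph (Fin (n - 1 + 1))} (h : IsSubpath P G) :
    ∃ e : Fin (n - 1 + 1) → Fin n, Function.Bijective e ∧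
      ∀ i j, P.Adj i j → G.Adj (e i) (e j) := by
  obtain ⟨hP, e, he, hadj⟩ := h
  refine ⟨e, (Fintype.bijective_iff_injective_and_card e).2 ⟨he, by simp; omega⟩, ?_⟩
  intro i j hij
  by_cases h : i = j
  · subst h; exact hG.2.1 _
  · exact (hadj i j ((hP.2 i j h).1 (Or.inl hij))).1 hij

instance {V : Type*} [Finite V] : Finite (Digraph V) :=
  Finite.of_injective (fun D : Digraph V => D.Adj) fun _ _ h => Digraph.ext h

theorem IsCycle.wordCondition_of_pathCondition (hG : IsCycle G) (h : PathCondition G) :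
    WordCondition G := by
  intro P hP
  by_contra! hW
  apply h
  obtain ⟨e, he, hadj⟩ := hP.exists_bijective_hom (by have := hG.1; omega) hG
  let S := {Q : Digraph (Fin (n - 2 + 1)) // IsPath Q ∧ Embeds Q G}
  let φ : S ≃ Fin (Nat.card S) := Finite.equivFin S
  let Q : Fin (Nat.card S) → Digraph (Fin (n - 2 + 1)) := fun i => (φ.symm i).1
  have hQ : ∀ i, IsPath (Q i) ∧ Embeds (Q i) G := fun i => (φ.symm i).2
  have hQ' : ∀ i, IsPath (Q i) := fun i => (hQ i).1
  obtain ⟨f, hf, h0, hb⟩ := exists_hom_of_walks (D := prodDigraph Q) (a := 0)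
    (b := fun _ => Fin.last _) hP.1 (walksTo_prod_nonempty hQ') (by
      rintro W ⟨c, hc, hc0, hc1⟩
      refine (wordLE_wordOf_iff hP.1 W).1 (hW W fun R hR hRG => ?_)
      have hφ : Q (φ ⟨R, hR, hRG⟩) = R := by simp [Q]
      rw [wordLE_wordOf_iff hR]
      refine ⟨fun j => c j (φ ⟨R, hR, hRG⟩), fun j hj => ?_, congrFun hc0 _, congrFun hc1 _⟩
      have := step_prodDigraph.1 (hc j hj) (φ ⟨R, hR, hRG⟩)
      rwa [hφ] at this)
  exact ⟨_, Q, hQ, ⟨fun x => e (f x), fun {x y} hxy => hadj _ _ (hf _ _ hxy)⟩,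
    he.2.comp (surjective_of_ends hQ' hP.1 hf h0 hb)⟩

theorem IsCycle.pathCondition_of_wordCondition (hG : IsCycle G) (hn : 4 ≤ n)
    (h : WordCondition G) : PathCondition G := by
  rintro ⟨l, Q, hQ, f, hf⟩
  have hn0 : 0 < n := by omega
  obtain ⟨F, hF, hF1⟩ := exists_lift_prod hn hG (fun i => (hQ i).1) (f := f)
    (fun x y hxy => f.map_rel hxy)
  obtain ⟨a, ha⟩ := Finite.exists_min F
  have hres : ∀ x, residue n hn0 (F x) = f x := fun x => residue_eq_of_dvd hn0 (hF x)
  -- The residue just below the minimum can only be attained at height `F a + n - 1` or above.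
  obtain ⟨b, hb⟩ := hf (residue n hn0 (F a - 1))
  have hFb : F a + (n - 1) ≤ F b := by
    rw [← hres b, residue_eq_iff] at hb
    have h1 : (n : ℤ) ∣ F b - F a + 1 := by convert hb using 2; ring
    have := Int.le_of_dvd (by have := ha b; omega) h1
    omega
  obtain ⟨W, hWQ, hWP⟩ := h _ (isSubpath_unroll hG hn0 (F a))
  apply hWP
  have hP := isPath_unroll hG hn0 (F a) (n - 1)
  -- Reverses of induced subpaths are induced subpaths too, so `a i` and `b i` may come in either
  -- order.
  have hc : ∀ i, ∃ c : ℕ → Fin (n - 2 + 1), IsWalk (Q i) W c ∧ c 0 = a i ∧ c W.length = b i :=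
    fun i => (hQ i).1.exists_isWalk (hWQ _ (hQ i).1 (hQ i).2)
      (hWQ _ (hQ i).1.reverse (hQ i).2.reverse) _ _
  choose c hc hc0 hc1 using hc
  rw [wordLE_wordOf_iff hP]
  let r : (Fin l → Fin (n - 2 + 1)) → Fin (n - 1 + 1) := fun x =>
    ⟨min (F x - F a).toNat (n - 1), by omega⟩
  have hr : ∀ x y, (prodDigraph Q).Adj x y → (unroll hn0 G (F a) (n - 1)).Adj (r x) (r y) := by
    intro x y hxy
    have h1 := abs_le.1 (hF1 x y hxy)
    have hx := ha x
    have hy := ha y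
    by_cases hne : r x = r y
    · rw [hne]; exact hP.1 _
    have hne' : (r x).val ≠ (r y).val := fun h => hne (Fin.ext h)
    simp only [r] at hne'
    -- Heights differ by at most 1, so distinct clipped values mean that neither was changed by
    -- clipping.
    have ex : F a + ((r x).val : ℤ) = F x := by simp only [r]; omega
    have ey : F a + ((r y).val : ℤ) = F y := by simp only [r]; omega
    refine ⟨by omega, by omega, ?_⟩
    rw [ex, ey, hres, hres]
    exact f.map_rel hxy
  refine ⟨fun j => r fun i => c i j, ?_, ?_, ?_⟩
  · exact IsWalk.map hr (c := fun j i => c i j) fun j hj =>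
      step_prodDigraph.2 fun i => hc i j hj
  · have : (fun i => c i 0) = a := funext hc0
    simp only [this]
    ext; simp [r]
  · have : (fun i => c i W.length) = b := funext hc1
    simp only [this]
    ext; simp only [r, Fin.val_last]; omega

/-- Homomorphic images of digraphs with a least and a greatest vertex in a reflexive digraph all of
whose transitive triangles are degenerate have at most two vertices. -/
theorem eq_or_eq_of_bounded {V W : Type*} {D : Digraph V} {G : Digraph W}
    (hG : ∀ u v w, G.Adj u v → G.Adj v w → G.Adj u w → v = u ∨ v = w)
    {f : V → W} (hf : ∀ x y, D.Adj x y → G.Adj (f x) (f y)) {a b : V}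
    (ha : ∀ x, D.Adj a x) (hb : ∀ x, D.Adj x b) (x : V) : f x = f a ∨ f x = f b :=
  hG _ _ _ (hf _ _ (ha x)) (hf _ _ (hb x)) (hf _ _ (ha b))

theorem IsPath.exists_least {P : Digraph (Fin (1 + 1))} (hP : IsPath P) :
    ∃ a b, (∀ x, P.Adj a x) ∧ ∀ x, P.Adj x b := by
  rcases hP.adj_or (u := 0) (v := 1) rfl with h | h
  · exact ⟨0, 1, fun x => by fin_cases x; exacts [hP.1 _, h],
      fun x => by fin_cases x; exacts [h, hP.1 _]⟩
  · exact ⟨1, 0, fun x => by fin_cases x; exacts [h, hP.1 _],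
      fun x => by fin_cases x; exacts [hP.1 _, h]⟩

theorem IsDirectedCycle.eq_or_eq {G : Digraph (Fin 3)} (hG : IsDirectedCycle G) (u v w : Fin 3)
    (h1 : G.Adj u v) (h2 : G.Adj v w) (h3 : G.Adj u w) : v = u ∨ v = w := by
  rcases hG.2 with h | h
  all_goals
    have a01 := h 0 1 rfl
    have a12 := h 1 2 rfl
    have a20 := h 2 0 rfl
    fin_cases u <;> fin_cases v <;> fin_cases w <;> simp_all

theorem IsDirectedCycle.pathCondition_three {G : Digraph (Fin 3)} (hG : IsDirectedCycle G) :
    PathCondition G := by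
  rintro ⟨l, Q, hQ, f, hf⟩
  choose a b ha hb using fun i => IsPath.exists_least (hQ i).1
  have key := eq_or_eq_of_bounded (D := prodDigraph Q) hG.eq_or_eq (f := f)
    (fun x y h => f.map_rel h) (a := a) (b := b) (fun x i => ha i _) (fun x i => hb i _)
  have hsub : (Finset.univ : Finset (Fin 3)) ⊆ {f a, f b} := fun v _ => by
    obtain ⟨x, rfl⟩ := hf v
    simpa using key x
  have := (Finset.card_le_card hsub).trans Finset.card_le_two
  simp at this

end Main

end ReflexiveCycle

theorem theorem3p9 {n : ℕ} (G : Digraph (Fin n)) (hG : ReflexiveCycle.IsCycle G) :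
    (ReflexiveCycle.PathCondition G → ReflexiveCycle.WordCondition G) ∧
    ((4 ≤ n ∨ ReflexiveCycle.IsDirectedCycle G) →
      (ReflexiveCycle.PathCondition G ↔ ReflexiveCycle.WordCondition G)) := by
  refine ⟨hG.wordCondition_of_pathCondition, fun h => ⟨hG.wordCondition_of_pathCondition, ?_⟩⟩
  intro hW
  by_cases hn : 4 ≤ n
  · exact hG.pathCondition_of_wordCondition hn hW
  · obtain rfl : n = 3 := by have := hG.1; omega
    exact (h.resolve_left hn).pathCondition_three
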